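/- Let $N$ be a positive integer, let $G=\Sigma_N$ be the symmetric group on $[N]=\{1,\dots,N\}$, and let $0\le j\le\lfloor N/2\rfloor$. Let $X_j$ be the set of elements of $G$ that are a product of $j$ disjoint transpositions. For $\sigma\in G$ and $\tau=(p_1\,p_2)\cdots(p_{2j-1}\,p_{2j})\in X_j$ with $p_{2k-1}<p_{2k}$ for all $k$, put $S(\sigma,\tau)=(-1)^{\#\{k:\ \sigma(p_{2k-1})>\sigma(p_{2k})\}}$. Let $V_j$ be the complex vector space with basis $X_j$, regarded as a representation of $G$ via $\sigma\cdot\tau=S(\sigma,\tau)\,\sigma\tau\sigma^{-1}$ for $\tau\in X_j$. Then: (a) $\dim_{\mathbb C}\operatorname{End}_G(V_j)$ is equal to the number of partitions of the integer $N$ with exactly $N-2j$ odd parts (counted with multiplicity). Call a pair $(\tau,\tau')\in X_j\times X_j$ admissible if there is no $\sigma\in G$ commuting with both $\tau$ and $\tau'$ such that $S(\sigma,\tau)S(\sigma,\tau')=-1$. The numerical characteristic partition $p(\tau,\tau')$ is the partition of $N$ given by the block sizes of the finest set partition of $[N]$ each of whose blocks is preserved by both $\tau$ and $\tau'$. (b)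 $\dim_{\mathbb C}\operatorname{End}_G(V_j)$ is also equal to the number of orbits, under simultaneous conjugation by $G$, of admissible pairs in $X_j\times X_j$. (c) Two admissible pairs lie in the same orbit if and only if they have the same numerical characteristic partition, and a partition of $N$ is the numerical characteristic partition of some admissible pair in $X_j\times X_j$ if and only if it has exactly $N-2j$ odd parts. -/

import Mathlib

namespace InvolutionModel

/-- `Invol N j`: the involutions of `{0, …, N-1}` that are a product of `j` disjoint
transpositions. -/
def Invol (N j : ℕ) : Type :=
  {τ : Equiv.Perm (Fin N) // τ.cycleType = Multiset.replicate j 2}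

/-- Every element of `Invol N j` has square one. -/
theorem Invol.apply_apply {N j : ℕ} (τ : Invol N j) (p : Fin N) : τ.1 (τ.1 p) = p := by
  have h : τ.1 ^ 2 = 1 := by
    rw [← orderOf_dvd_iff_pow_eq_one, ← Equiv.Perm.lcm_cycleType, τ.2, Multiset.lcm_dvd]
    intro b hb
    rw [Multiset.eq_of_mem_replicate hb]
  have h2 := congrArg (fun f : Equiv.Perm (Fin N) => f p) h
  simpa [pow_two] using h2

/-- The symmetric group acts on `Invol N j` by conjugation; on `Invol N j × Invol N j` the
product action is simultaneous conjugation. -/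
instance (N j : ℕ) : MulAction (Equiv.Perm (Fin N)) (Invol N j) where
  smul σ τ := ⟨σ * τ.1 * σ⁻¹, by rw [Equiv.Perm.cycleType_conj]; exact τ.2⟩
  one_smul τ := Subtype.ext (show 1 * τ.1 * 1⁻¹ = τ.1 by simp)
  mul_smul σ' σ τ := Subtype.ext
    (show σ' * σ * τ.1 * (σ' * σ)⁻¹ = σ' * (σ * τ.1 * σ⁻¹) * σ'⁻¹ by group)

theorem Invol.smul_val {N j : ℕ} (σ : Equiv.Perm (Fin N)) (τ : Invol N j) :
    (σ • τ).1 = σ * τ.1 * σ⁻¹ := rfl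

/-- The sign `S(σ, τ)`: `(-1)` to the number of transpositions `(p q)`, `p < q`, of the
involution `τ` with `σ p > σ q`. -/
def sgn {N : ℕ} (σ τ : Equiv.Perm (Fin N)) : ℤ :=
  (-1) ^ (Finset.univ.filter fun p : Fin N => p < τ p ∧ σ (τ p) < σ p).card

theorem sgn_eq_prod {N : ℕ} (σ τ : Equiv.Perm (Fin N)) :
    sgn σ τ = ∏ p ∈ Finset.univ.filter (fun p : Fin N => p < τ p),
      (if σ (τ p) < σ p then -1 else 1) := by
  rw [Finset.prod_ite, Finset.prod_const, Finset.prod_const_one, mul_one, Finset.filter_filter]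
  rfl

theorem sgn_one {N : ℕ} (τ : Equiv.Perm (Fin N)) : sgn 1 τ = 1 := by
  have h : (Finset.univ.filter fun p : Fin N =>
      p < τ p ∧ (1 : Equiv.Perm (Fin N)) (τ p) < (1 : Equiv.Perm (Fin N)) p) = ∅ := by
    refine Finset.filter_eq_empty_iff.2 ?_
    rintro p - ⟨h1, h2⟩
    exact lt_asymm h1 h2
  unfold sgn
  rw [h]
  simp

/-- The cocycle identity for the sign. -/
theorem sgn_mul {N j : ℕ} (σ' σ : Equiv.Perm (Fin N)) (τ : Invol N j) :
    sgn (σ' * σ) τ.1 = sgn σ' (σ • τ).1 * sgn σ τ.1 := by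
  have hτ := τ.apply_apply
  have hc : ∀ p, (σ • τ).1 (σ p) = σ (τ.1 p) := by
    intro p
    simp [Invol.smul_val]
  have hc' : ∀ q, τ.1 (σ⁻¹ q) = σ⁻¹ ((σ • τ).1 q) := by
    intro p
    simp [Invol.smul_val]
  have hi : ∀ p, σ⁻¹ (σ p) = p := by simp
  have hi' : ∀ p, σ (σ⁻¹ p) = p := by simp
  have hne : ∀ p, p < τ.1 p → σ (τ.1 p) ≠ σ p := by
    intro p hp h
    exact hp.ne' (σ.injective h)
  have key : sgn σ' (σ • τ).1 = ∏ p ∈ Finset.univ.filter (fun p : Fin N => p < τ.1 p),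
      (if σ (τ.1 p) < σ p then (if σ' (σ p) < σ' (σ (τ.1 p)) then -1 else 1)
        else (if σ' (σ (τ.1 p)) < σ' (σ p) then -1 else 1)) := by
    rw [sgn_eq_prod]
    symm
    refine Finset.prod_bij' (fun p _ => min (σ p) (σ (τ.1 p)))
      (fun q _ => min (σ⁻¹ q) (τ.1 (σ⁻¹ q))) ?_ ?_ ?_ ?_ ?_
    · intro p hp
      simp only [Finset.mem_filter, Finset.mem_univ, true_and] at hp ⊢
      rcases lt_or_gt_of_ne (hne p hp) with h | h
      · rw [min_eq_right h.le, hc, hτ]; exact h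
      · rw [min_eq_left h.le, hc]; exact h
    · intro q hq
      simp only [Finset.mem_filter, Finset.mem_univ, true_and] at hq ⊢
      have hn : σ⁻¹ q ≠ τ.1 (σ⁻¹ q) := by
        rw [hc']
        intro h
        exact hq.ne (σ⁻¹.injective h)
      rcases lt_or_gt_of_ne hn with h | h
      · rw [min_eq_left h.le]; exact h
      · rw [min_eq_right h.le, hτ]; exact h
    · intro p hp
      simp only [Finset.mem_filter, Finset.mem_univ, true_and] at hp
      rcases lt_or_gt_of_ne (hne p hp) with h | h
      · simp only [min_eq_right h.le, hi, hτ, min_eq_right hp.le]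
      · simp only [min_eq_left h.le, hi, min_eq_left hp.le]
    · intro q hq
      simp only [Finset.mem_filter, Finset.mem_univ, true_and] at hq
      have e1 : σ (τ.1 (σ⁻¹ q)) = (σ • τ).1 q := by rw [hc']; simp
      rcases le_total (σ⁻¹ q) (τ.1 (σ⁻¹ q)) with h | h
      · simp only [min_eq_left h, e1, hi', min_eq_left hq.le]
      · simp only [min_eq_right h, hτ, e1, hi', min_eq_right hq.le]
    · intro p hp
      simp only [Finset.mem_filter, Finset.mem_univ, true_and] at hp
      rcases lt_or_gt_of_ne (hne p hp) with h | h
      · simp only [min_eq_right h.le, hc, hτ, if_pos h]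
      · simp only [min_eq_left h.le, hc, if_neg h.not_gt]
  rw [key, sgn_eq_prod, sgn_eq_prod, ← Finset.prod_mul_distrib]
  refine Finset.prod_congr rfl ?_
  intro p hp
  simp only [Finset.mem_filter, Finset.mem_univ, true_and] at hp
  have h2 : σ' (σ (τ.1 p)) ≠ σ' (σ p) := fun h => hne p hp (σ'.injective h)
  simp only [Equiv.Perm.mul_apply]
  rcases lt_or_gt_of_ne h2 with h | h <;> by_cases h3 : σ (τ.1 p) < σ p <;>
    simp [h, h3, h.not_gt]

/-- The representation `π_j` of the symmetric group on the complex vector space `V_j` with basis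
`Invol N j`: on basis vectors, `π_j(σ) τ = S(σ, τ) · (σ τ σ⁻¹)`. -/
noncomputable def rep (N j : ℕ) :
    Representation ℂ (Equiv.Perm (Fin N)) (Invol N j →₀ ℂ) where
  toFun σ := Finsupp.linearCombination ℂ
    (fun τ : Invol N j => Finsupp.single (σ • τ) ((sgn σ τ.1 : ℤ) : ℂ))
  map_one' := by
    refine Finsupp.lhom_ext fun τ c => ?_
    simp [sgn_one]
  map_mul' σ' σ := by
    refine Finsupp.lhom_ext fun τ c => ?_
    simp only [Module.End.mul_apply, Finsupp.linearCombination_single, Finsupp.smul_single,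
      smul_eq_mul, mul_smul, sgn_mul, Int.cast_mul]
    congr 1
    ring

/-- The representation on the distinguished basis. -/
theorem rep_single {N j : ℕ} (σ : Equiv.Perm (Fin N)) (τ : Invol N j) :
    rep N j σ (Finsupp.single τ 1) = ((sgn σ τ.1 : ℤ) : ℂ) • Finsupp.single (σ • τ) 1 := by
  simp [rep]

/-- Some permutation commuting with both members of the pair reverses the sign. -/
def HasSignReversal {N j : ℕ} (x : Invol N j × Invol N j) : Prop :=
  ∃ σ : Equiv.Perm (Fin N), Commute σ x.1.1 ∧ Commute σ x.2.1 ∧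
    sgn σ x.1.1 * sgn σ x.2.1 = -1

/-- The characteristic partition of `(τ, κ)`: the finest partition of `{0, …, N-1}`, given as an
equivalence relation, each of whose blocks is preserved by both `τ` and `κ`. -/
def charSetoid {N : ℕ} (τ κ : Equiv.Perm (Fin N)) : Setoid (Fin N) :=
  sInf {r : Setoid (Fin N) | ∀ p, r p (τ p) ∧ r p (κ p)}

open Classical in
/-- The numerical characteristic partition of `(τ, κ)`: the partition of the integer `N` formed by
the sizes of the blocks of the characteristic partition. -/
noncomputable def numPartition {N : ℕ} (τ κ : Equiv.Perm (Fin N)) : Nat.Partition N where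
  parts := (Finpartition.ofSetoid (charSetoid τ κ)).parts.val.map Finset.card
  parts_pos := by
    intro i hi
    obtain ⟨H, hH, rfl⟩ := Multiset.mem_map.1 hi
    exact Finset.card_pos.2 ((Finpartition.ofSetoid (charSetoid τ κ)).nonempty_of_mem_parts hH)
  parts_sum := by
    have h := (Finpartition.ofSetoid (charSetoid τ κ)).sum_card_parts
    rw [Finset.card_univ, Fintype.card_fin] at h
    exact h

/-- The number of odd parts, with multiplicity, of a partition of an integer. -/
def numOddParts {N : ℕ} (p : Nat.Partition N) : ℕ :=
  (p.parts.filter fun i => Odd i).card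

end InvolutionModel

/-! An intertwining endomorphism of `rep N j` is a matrix indexed by pairs of involutions that,
along a conjugation by σ, is multiplied by the product of the two signs. Such a function vanishes at
a pair whose stabilizer takes the value -1, and on any other orbit it is fixed by one arbitrary
value. The dimension is therefore the number of orbits of pairs without sign reversal
(`finrank_intertwiningMap`).

To classify these orbits, draw the transpositions of τ and κ as edges of two kinds on the N points.
The blocks of the characteristic partition are the components, which are alternating paths or
cycles. A path with 2k vertices has k edges of one kind and k - 1 of the other; its reversal
commutes with both involutions and flips each of these 2k - 1 edges, so it reverses the sign
(`hasSignReversal_of_even_path`). Without such paths, the points have a 2-colouring that alternates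
along every edge and is +1 at all fixed points. Computing one sign with this colouring and the other
with its negative makes the factors cancel in pairs (`not_hasSignReversal_of_coloring`).

Hence the admissible pairs are the disjoint unions of even cycles and odd paths
(`exists_isStandardForm`), determined up to conjugation by their block sizes. An odd path contains
one fixed point of each involution and a cycle none, so the number of odd blocks is the common
number N - 2j of fixed points. -/

namespace InvolutionModel

/-! ### Twisted invariants and orbits -/

/-- The functions on a `G`-set that transform through a family of scalars. -/
def twistedInvariants {G X : Type*} [Group G] [MulAction G X] (χ : G → X → ℂ) :
    Submodule ℂ (X → ℂ) where
  carrier := {M | ∀ g x, M (g • x) = χ g x * M x}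
  add_mem' hM hM' g x := by simp only [Pi.add_apply, hM g x, hM' g x, mul_add]
  zero_mem' g x := by simp
  smul_mem' c M hM g x := by simp only [Pi.smul_apply, smul_eq_mul, hM g x]; ring

/-- Evaluation at one representative of each orbit with trivial stabilizer character is an
isomorphism onto the functions on the set of these orbits. -/
theorem finrank_twistedInvariants {G X : Type*} [Group G] [MulAction G X] [Finite X]
    (χ : G → X → ℂ) (χ_mul : ∀ g h x, χ (g * h) x = χ g (h • x) * χ h x) :
    Module.finrank ℂ (twistedInvariants χ) =
      {O : Set X | ∃ x, (∀ g : G, g • x = x → χ g x = 1) ∧ O = MulAction.orbit G x}.ncard := by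
  classical
  set S : Set (Set X) :=
    {O : Set X | ∃ x, (∀ g : G, g • x = x → χ g x = 1) ∧ O = MulAction.orbit G x} with hS
  have hex : ∀ O : S, ∃ x, (∀ g : G, g • x = x → χ g x = 1) ∧ (O : Set X) = MulAction.orbit G x :=
    fun O => O.2
  choose r hr hO using hex
  have : Finite S := Subtype.finite
  have : Fintype S := Fintype.ofFinite S
  let F : twistedInvariants χ →ₗ[ℂ] (S → ℂ) :=
    { toFun := fun M O => M.1 (r O)
      map_add' := fun _ _ => rfl
      map_smul' := fun _ _ => rfl }
  have hinj : Function.Injective F := by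
    rw [← LinearMap.ker_eq_bot, LinearMap.ker_eq_bot']
    intro M hM
    ext y
    change M.1 y = 0
    by_cases hy : ∀ g : G, g • y = y → χ g y = 1
    · have hyO : y ∈ MulAction.orbit G (r ⟨MulAction.orbit G y, y, hy, rfl⟩) := by
        rw [← hO]
        exact MulAction.mem_orbit_self y
      obtain ⟨g, hg⟩ := hyO
      have h0 := congrFun hM ⟨MulAction.orbit G y, y, hy, rfl⟩
      have h1 := M.2 g (r ⟨MulAction.orbit G y, y, hy, rfl⟩)
      change M.1 (r ⟨MulAction.orbit G y, y, hy, rfl⟩) = 0 at h0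
      rw [h0, mul_zero] at h1
      rw [← hg]
      exact h1
    -- Some stabilizer element has scalar different from 1, which forces the value at `y` to be 0.
    · push Not at hy
      obtain ⟨g, hg, hχ⟩ := hy
      have h1 := M.2 g y
      rw [hg] at h1
      have h2 : (χ g y - 1) * M.1 y = 0 := by linear_combination -h1
      exact (mul_eq_zero.1 h2).resolve_left (sub_ne_zero.2 hχ)
  have hsurj : Function.Surjective F := by
    intro c
    -- Transport the prescribed values along the good orbits and put 0 elsewhere; `key` shows that
    -- the chosen transporter does not matter.
    let M : X → ℂ := fun y =>
      if h : ∃ z : S × G, z.2 • r z.1 = y then χ h.choose.2 (r h.choose.1) * c h.choose.1 else 0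
    have key : ∀ (O : S) (g : G), M (g • r O) = χ g (r O) * c O := by
      intro O g
      have h : ∃ z : S × G, z.2 • r z.1 = g • r O := ⟨(O, g), rfl⟩
      have hM : M (g • r O) = χ h.choose.2 (r h.choose.1) * c h.choose.1 := dif_pos h
      rw [hM]
      have hz := h.choose_spec
      generalize h.choose = z at hz ⊢
      obtain ⟨O', g'⟩ := z
      simp only at hz ⊢
      have hOO : O' = O := by
        apply Subtype.ext
        rw [hO, hO, ← MulAction.orbit_smul g', hz, MulAction.orbit_smul]
      subst hOO
      -- Two transporters to the same point differ by a stabilizer element, whose scalar is 1.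
      have hfix : (g⁻¹ * g') • r O' = r O' := by rw [mul_smul, hz, inv_smul_smul]
      have := χ_mul g (g⁻¹ * g') (r O')
      rw [hfix, hr O' _ hfix, mul_one, mul_inv_cancel_left] at this
      rw [this]
    refine ⟨⟨M, ?_⟩, ?_⟩
    · intro g y
      by_cases h : ∃ z : S × G, z.2 • r z.1 = y
      · obtain ⟨⟨O, g'⟩, rfl⟩ := h
        simp only
        rw [← mul_smul, key, key, χ_mul, mul_assoc]
      · have h' : ¬ ∃ z : S × G, z.2 • r z.1 = g • y := by
          rintro ⟨⟨O, g'⟩, hz⟩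
          exact h ⟨(O, g⁻¹ * g'), by rw [mul_smul, hz, inv_smul_smul]⟩
        have e1 : M y = 0 := dif_neg h
        have e2 : M (g • y) = 0 := dif_neg h'
        rw [e1, e2, mul_zero]
    · funext O
      have h1 := key O 1
      have h2 := χ_mul 1 1 (r O)
      have h3 := hr O 1 (one_smul _ _)
      rw [one_smul, h3, one_mul] at h1
      exact h1
  rw [(LinearEquiv.ofBijective F ⟨hinj, hsurj⟩).finrank_eq, Module.finrank_fintype_fun_eq_card,
    ← Nat.card_eq_fintype_card]
  rfl

/-! ### Endomorphisms as twisted functions on pairs -/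

variable {N j : ℕ}

instance : Finite (Invol N j) := Subtype.finite

theorem sgn_mul_self (σ τ : Equiv.Perm (Fin N)) : sgn σ τ * sgn σ τ = 1 := by
  unfold sgn
  rw [← mul_pow]
  simp

/-- The scalar by which a permutation acts on the basis vector attached to a pair. -/
noncomputable def pairSign (σ : Equiv.Perm (Fin N)) (x : Invol N j × Invol N j) : ℂ :=
  ((sgn σ x.1.1 * sgn σ x.2.1 : ℤ) : ℂ)

theorem pairSign_mul (σ' σ : Equiv.Perm (Fin N)) (x : Invol N j × Invol N j) :
    pairSign (σ' * σ) x = pairSign σ' (σ • x) * pairSign σ x := by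
  simp only [pairSign, sgn_mul, Prod.smul_fst, Prod.smul_snd]
  push_cast
  ring

theorem Invol.smul_eq_iff_commute (σ : Equiv.Perm (Fin N)) (τ : Invol N j) :
    σ • τ = τ ↔ Commute σ τ.1 := by
  have h : σ • τ = τ ↔ (σ • τ).1 = τ.1 := ⟨fun h => by rw [h], Subtype.ext⟩
  rw [h, Invol.smul_val, mul_inv_eq_iff_eq_mul]
  rfl

/-- The product of signs is always 1 or -1, so admissibility says exactly that the stabilizer acts
by trivial scalars. -/
theorem not_hasSignReversal_iff (x : Invol N j × Invol N j) :
    ¬ HasSignReversal x ↔ ∀ σ : Equiv.Perm (Fin N), σ • x = x → pairSign σ x = 1 := by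
  have hfix : ∀ σ : Equiv.Perm (Fin N),
      σ • x = x ↔ Commute σ x.1.1 ∧ Commute σ x.2.1 := by
    intro σ
    rw [Prod.ext_iff, Prod.smul_fst, Prod.smul_snd, Invol.smul_eq_iff_commute,
      Invol.smul_eq_iff_commute]
  have hsq : ∀ σ : Equiv.Perm (Fin N),
      sgn σ x.1.1 * sgn σ x.2.1 = 1 ∨ sgn σ x.1.1 * sgn σ x.2.1 = -1 := by
    intro σ
    rw [← sq_eq_one_iff]
    linear_combination sgn_mul_self σ x.1.1 * (sgn σ x.2.1) ^ 2 + sgn_mul_self σ x.2.1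
  constructor
  · intro h σ hσ
    rcases hsq σ with h1 | h1
    · rw [pairSign, h1, Int.cast_one]
    · exact absurd ⟨σ, ((hfix σ).1 hσ).1, ((hfix σ).1 hσ).2, h1⟩ h
  · rintro h ⟨σ, h1, h2, h3⟩
    have := h σ ((hfix σ).2 ⟨h1, h2⟩)
    rw [pairSign, h3] at this
    norm_num at this

theorem rep_apply_smul (σ : Equiv.Perm (Fin N)) (v : Invol N j →₀ ℂ) (κ : Invol N j) :
    rep N j σ v (σ • κ) = ((sgn σ κ.1 : ℤ) : ℂ) * v κ := by
  classical
  induction v using Finsupp.induction_linear with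
  | zero => simp
  | add v w hv hw => rw [map_add, Finsupp.add_apply, hv, hw, Finsupp.add_apply, mul_add]
  | single τ c =>
    have h : rep N j σ (Finsupp.single τ c) =
        c • ((sgn σ τ.1 : ℤ) : ℂ) • Finsupp.single (σ • τ) 1 := by
      rw [← rep_single, ← map_smul, Finsupp.smul_single, smul_eq_mul, mul_one]
    rw [h]
    by_cases hτ : τ = κ
    · subst hτ
      simp [mul_comm]
    · have : σ • τ ≠ σ • κ := fun h => hτ (smul_left_cancel σ h)
      simp [hτ, this]

/-- An intertwining endomorphism is determined by its matrix, which is an arbitrary function on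
pairs with the right transformation behaviour. -/
noncomputable def intertwiningEquiv (N j : ℕ) :
    Representation.IntertwiningMap (rep N j) (rep N j) ≃ₗ[ℂ]
      twistedInvariants (pairSign : Equiv.Perm (Fin N) → Invol N j × Invol N j → ℂ) where
  toFun f := ⟨fun x => f (Finsupp.single x.1 1) x.2, by
    rintro σ ⟨τ, κ⟩
    have h := f.isIntertwining _ _ σ (Finsupp.single τ 1)
    rw [rep_single, map_smul] at h
    have h1 := DFunLike.congr_fun h (σ • κ)
    rw [rep_apply_smul, Finsupp.smul_apply, smul_eq_mul] at h1
    have h2 : ((sgn σ τ.1 : ℤ) : ℂ) * ((sgn σ τ.1 : ℤ) : ℂ) = 1 := by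
      exact_mod_cast sgn_mul_self σ τ.1
    simp only [Prod.smul_mk, pairSign]
    push_cast
    linear_combination ((sgn σ τ.1 : ℤ) : ℂ) * h1 - f (Finsupp.single (σ • τ) 1) (σ • κ) * h2⟩
  map_add' _ _ := rfl
  map_smul' _ _ := rfl
  invFun M :=
    (Finsupp.linearCombination ℂ fun τ : Invol N j =>
      Finsupp.equivFunOnFinite.symm fun κ => M.1 (τ, κ)).intertwiningMap_of_isIntertwiningMap
      _ _ (by
        intro σ v
        induction v using Finsupp.induction_linear with
        | zero => simp
        | add v w hv hw => simp only [map_add, hv, hw]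
        | single τ c =>
          have h : (Finsupp.single τ c : Invol N j →₀ ℂ) = c • Finsupp.single τ 1 := by simp
          rw [h]
          simp only [map_smul, rep_single, Finsupp.linearCombination_single, one_smul]
          congr 1
          ext κ
          obtain ⟨κ, rfl⟩ : ∃ κ', σ • κ' = κ := ⟨σ⁻¹ • κ, smul_inv_smul _ _⟩
          rw [rep_apply_smul]
          have h1 := M.2 σ (τ, κ)
          have h2 : ((sgn σ τ.1 : ℤ) : ℂ) * ((sgn σ τ.1 : ℤ) : ℂ) = 1 := by
            exact_mod_cast sgn_mul_self σ τ.1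
          simp only [Prod.smul_mk, pairSign] at h1
          push_cast at h1
          simp only [Finsupp.smul_apply, Finsupp.equivFunOnFinite_symm_apply_apply, smul_eq_mul, h1]
          linear_combination ((sgn σ κ.1 : ℤ) : ℂ) * M.1 (τ, κ) * h2)
  left_inv f := by
    apply Representation.IntertwiningMap.ext
    refine Finsupp.lhom_ext' fun τ => LinearMap.ext_ring ?_
    ext κ
    simp [LinearMap.intertwiningMap_of_isIntertwiningMap]
  right_inv M := by
    ext x
    simp [LinearMap.intertwiningMap_of_isIntertwiningMap]

theorem finrank_intertwiningMap (N j : ℕ) :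
    Module.finrank ℂ (Representation.IntertwiningMap (rep N j) (rep N j)) =
      {O : Set (Invol N j × Invol N j) |
        ∃ x, ¬ HasSignReversal x ∧ O = MulAction.orbit (Equiv.Perm (Fin N)) x}.ncard := by
  rw [(intertwiningEquiv N j).finrank_eq, finrank_twistedInvariants _ pairSign_mul]
  simp only [not_hasSignReversal_iff]

/-! ### Signs computed from colourings -/

/-- The products of a `τ`-invariant function over two transversals of the `τ`-edges agree. -/
theorem prod_transversal_eq {α : Type*} [DecidableEq α] {τ : Equiv.Perm α}
    (hτ : ∀ p, τ (τ p) = p) {A B : Finset α} (hA : ∀ p ∈ A, τ p ≠ p)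
    (hA' : ∀ p, τ p ≠ p → (τ p ∈ A ↔ p ∉ A)) (hB : ∀ p ∈ B, τ p ≠ p)
    (hB' : ∀ p, τ p ≠ p → (τ p ∈ B ↔ p ∉ B)) {g : α → ℤ}
    (hg : ∀ p, τ p ≠ p → g (τ p) = g p) : ∏ p ∈ A, g p = ∏ p ∈ B, g p := by
  -- Each edge has exactly one endpoint in each transversal; the bijection picks the endpoint of the
  -- same edge.
  refine Finset.prod_bij' (fun p _ => if p ∈ B then p else τ p)
    (fun p _ => if p ∈ A then p else τ p) ?_ ?_ ?_ ?_ ?_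
  · intro p hp
    by_cases h : p ∈ B
    · simp [h]
    · simp [h, hB' p (hA p hp)]
  · intro p hp
    by_cases h : p ∈ A
    · simp [h]
    · simp [h, hA' p (hB p hp)]
  · intro p hp
    by_cases h : p ∈ B
    · simp [h, hp]
    · simp [h, hp, hA' p (hA p hp), hτ]
  · intro p hp
    by_cases h : p ∈ A
    · simp [h, hp]
    · simp [h, hp, hB' p (hB p hp), hτ]
  · intro p hp
    by_cases h : p ∈ B
    · simp [h]
    · simp [h, hg p (hA p hp)]

/-- The sign of a permutation commuting with `τ`, computed from an arbitrary orientation `s` of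
the `τ`-edges instead of the one given by the order. -/
theorem sgn_eq_prod_of_commute {σ τ : Equiv.Perm (Fin N)} (hτ : ∀ p, τ (τ p) = p)
    (hστ : Commute σ τ) {s : Fin N → ℤ} (hs : ∀ p, s p = 1 ∨ s p = -1)
    (hsτ : ∀ p, τ p ≠ p → s (τ p) = -s p) :
    sgn σ τ = ∏ p ∈ Finset.univ.filter (fun p => s p = 1 ∧ τ p ≠ p), s (σ p) := by
  have hc : ∀ p, σ (τ p) = τ (σ p) := fun p => Equiv.Perm.ext_iff.1 hστ.eq p
  have hfix : ∀ p, τ p ≠ p → τ (σ p) ≠ σ p := by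
    intro p hp h
    rw [← hc] at h
    exact hp (σ.injective h)
  have hss : ∀ p, s p * s p = 1 := by
    intro p
    rcases hs p with h | h <;> simp [h]
  set u : Fin N → ℤ := fun p => if p < τ p then 1 else -1 with hu
  have huu : ∀ p, u p * u p = 1 := by
    intro p
    by_cases h : p < τ p <;> simp [hu, h]
  have huτ : ∀ p, τ p ≠ p → u (τ p) = -u p := by
    intro p hp
    simp only [hu, hτ]
    rcases lt_or_gt_of_ne hp with h | h <;> simp [h, h.not_gt]
  set L : Finset (Fin N) := Finset.univ.filter fun p => p < τ p with hL
  have hL1 : ∀ p ∈ L, τ p ≠ p := by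
    intro p hp
    exact (Finset.mem_filter.1 hp).2.ne'
  have hL2 : ∀ p, τ p ≠ p → (τ p ∈ L ↔ p ∉ L) := by
    intro p hp
    simp only [hL, Finset.mem_filter, Finset.mem_univ, true_and, hτ, not_lt]
    exact ⟨le_of_lt, fun h => lt_of_le_of_ne h hp⟩
  have hσL : ∀ g : Fin N → ℤ, (∀ p, τ p ≠ p → g (τ p) = g p) →
      ∏ p ∈ L, g (σ p) = ∏ p ∈ L, g p := by
    intro g hg
    have := Finset.prod_map L σ.toEmbedding g
    simp only [Equiv.coe_toEmbedding] at this
    rw [← this]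
    have hmem : ∀ p, p ∈ L.map σ.toEmbedding ↔ σ.symm p ∈ L := by
      intro p
      rw [Finset.mem_map_equiv]
    have hc' : ∀ p, σ.symm (τ p) = τ (σ.symm p) := by
      intro p
      rw [Equiv.symm_apply_eq, hc, Equiv.apply_symm_apply]
    have hfix' : ∀ p, τ p ≠ p → τ (σ.symm p) ≠ σ.symm p := by
      intro p hp h
      rw [← hc'] at h
      exact hp (σ.symm.injective h)
    refine prod_transversal_eq hτ ?_ ?_ hL1 hL2 hg
    · intro p hp h
      rw [hmem] at hp
      exact hL1 _ hp (by rw [← hc', h])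
    · intro p hp
      rw [hmem, hmem, hc', hL2 _ (hfix' p hp)]
  -- The ratio of two orientations is constant on each edge, and σ permutes the edges. The
  -- correction for replacing `u` by `s` is thus the same before and after applying σ, and it
  -- cancels.
  have ho : ∏ p ∈ L, (u (σ p) * s (σ p)) = ∏ p ∈ L, (u p * s p) := by
    refine hσL (fun p => u p * s p) ?_
    intro p hp
    simp only [huτ p hp, hsτ p hp]
    ring
  have hsq : (∏ p ∈ L, (u p * s p)) * ∏ p ∈ L, (u p * s p) = 1 := by
    rw [← Finset.prod_mul_distrib]
    refine Finset.prod_eq_one fun p _ => ?_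
    linear_combination s p * s p * huu p + hss p
  have h1 : sgn σ τ = ∏ p ∈ L, (u (σ p) * u p) := by
    rw [sgn_eq_prod]
    refine Finset.prod_congr rfl fun p hp => ?_
    have hp' := hfix p (hL1 p hp)
    have hp2 : p < τ p := (Finset.mem_filter.1 hp).2
    simp only [hu, hc, if_pos hp2, mul_one]
    rcases lt_or_gt_of_ne hp' with h | h <;> simp [h, h.not_gt]
  have h2 : ∏ p ∈ L, (u (σ p) * u p) =
      (∏ p ∈ L, (u (σ p) * s (σ p))) * (∏ p ∈ L, (u p * s p)) * ∏ p ∈ L, (s (σ p) * s p) := by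
    rw [← Finset.prod_mul_distrib, ← Finset.prod_mul_distrib]
    refine Finset.prod_congr rfl fun p _ => ?_
    linear_combination -(u (σ p) * u p * s p * s p) * hss (σ p) - u (σ p) * u p * hss p
  rw [h1, h2, ho, hsq, one_mul]
  have h3 : ∏ p ∈ L, (s (σ p) * s p) =
      ∏ p ∈ Finset.univ.filter (fun p => s p = 1 ∧ τ p ≠ p), (s (σ p) * s p) := by
    refine prod_transversal_eq hτ hL1 hL2 ?_ ?_ ?_
    · intro p hp
      exact (Finset.mem_filter.1 hp).2.2
    · intro p hp
      have hp' : p ≠ τ p := hp.symm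
      simp only [Finset.mem_filter, Finset.mem_univ, true_and, hτ, hsτ p hp, ne_eq, hp, hp',
        not_false_eq_true, and_true]
      rcases hs p with h | h <;> simp [h]
    · intro p hp
      rw [hc, hsτ p hp, hsτ _ (hfix p hp)]
      ring
  rw [h3]
  refine Finset.prod_congr rfl fun p hp => ?_
  rw [(Finset.mem_filter.1 hp).2.1, mul_one]

/-- A colouring that alternates along both kinds of edges and is constant on the fixed points
excludes sign reversals. -/
theorem not_hasSignReversal_of_coloring {x : Invol N j × Invol N j} {s : Fin N → ℤ}
    (hs : ∀ p, s p = 1 ∨ s p = -1)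
    (h1 : ∀ p, x.1.1 p ≠ p → s (x.1.1 p) = -s p) (h2 : ∀ p, x.2.1 p ≠ p → s (x.2.1 p) = -s p)
    (h1' : ∀ p, x.1.1 p = p → s p = 1) (h2' : ∀ p, x.2.1 p = p → s p = 1) :
    ¬ HasSignReversal x := by
  rintro ⟨σ, hσ1, hσ2, h⟩
  have hs' : ∀ p, -s p = 1 ∨ -s p = -1 := by
    intro p
    rcases hs p with h | h <;> simp [h]
  have hc : ∀ p, σ (x.1.1 p) = x.1.1 (σ p) := fun p => Equiv.Perm.ext_iff.1 hσ1.eq p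
  have e1 := sgn_eq_prod_of_commute x.1.apply_apply hσ1 hs h1
  have e2 := sgn_eq_prod_of_commute (s := fun p => -s p) x.2.apply_apply hσ2 hs'
    (fun p hp => by rw [h2 p hp])
  have f1 : ∏ p ∈ Finset.univ.filter (fun p => s p = 1 ∧ x.1.1 p ≠ p), s (σ p) =
      ∏ p ∈ (Finset.univ.filter fun p => x.1.1 p ≠ p).filter (fun p => s p = 1),
        (s (σ p) * s p) := by
    rw [Finset.filter_filter]
    refine Finset.prod_congr (Finset.filter_congr fun p _ => and_comm) fun p hp => ?_
    rw [(Finset.mem_filter.1 hp).2.2, mul_one]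
  -- All fixed points have colour 1, so a point of colour -1 is moved by both involutions. The two
  -- sign products therefore run together over all points moved by the first involution.
  have f2 : ∏ p ∈ Finset.univ.filter (fun p => -s p = 1 ∧ x.2.1 p ≠ p), -s (σ p) =
      ∏ p ∈ (Finset.univ.filter fun p => x.1.1 p ≠ p).filter (fun p => ¬ s p = 1),
        (s (σ p) * s p) := by
    rw [Finset.filter_filter]
    refine Finset.prod_congr (Finset.filter_congr fun p _ => ?_) fun p hp => ?_
    · constructor
      · rintro ⟨h3, -⟩
        have : ¬ s p = 1 := by omega
        exact ⟨fun h4 => this (h1' p h4), this⟩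
      · rintro ⟨-, h4⟩
        exact ⟨by have := hs p; omega, fun h5 => h4 (h2' p h5)⟩
    · have h5 := (Finset.mem_filter.1 hp).2.2
      rw [(hs p).resolve_left h5, mul_neg_one]
  rw [e1, e2, f1, f2, Finset.prod_filter_mul_prod_filter_not] at h
  -- The two endpoints of an edge contribute equal factors, each 1 or -1.
  have h3 : ∏ p ∈ Finset.univ.filter (fun p => x.1.1 p ≠ p), (s (σ p) * s p) = 1 := by
    refine Finset.prod_involution (fun p _ => x.1.1 p) ?_ ?_ ?_ ?_
    · intro p hp
      have hp' := (Finset.mem_filter.1 hp).2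
      have hp2 : x.1.1 (σ p) ≠ σ p := by
        rw [← hc]
        exact fun h => hp' (σ.injective h)
      rw [hc, h1 p hp', h1 _ hp2]
      rcases hs p with h | h <;> rcases hs (σ p) with h' | h' <;> simp [h, h']
    · intro p hp _
      exact (Finset.mem_filter.1 hp).2
    · intro p hp
      simpa [x.1.apply_apply, eq_comm] using hp
    · intro p _
      exact x.1.apply_apply p
  rw [h3] at h
  norm_num at h

theorem HasSignReversal.swap {x : Invol N j × Invol N j} (h : HasSignReversal x) :
    HasSignReversal x.swap := by
  obtain ⟨σ, h1, h2, h3⟩ := h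
  exact ⟨σ, h2, h1, by rw [← h3, mul_comm]; rfl⟩

/-! ### Even paths -/

/-- The reversal of a path with an even number of vertices changes the sign. -/
theorem hasSignReversal_of_even_path {x : Invol N j × Invol N j} {m : ℕ} (hm : Even m)
    (hm0 : 0 < m) {f : ℕ → Fin N} (hf : ∀ a b, a < m → b < m → f a = f b → a = b)
    (h1 : ∀ a < m, x.1.1 (f a) = f (if a % 2 = 0 then a + 1 else a - 1))
    (h2 : ∀ a < m, x.2.1 (f a) =
      f (if a % 2 = 0 then a - 1 else if a + 1 < m then a + 1 else a)) :
    HasSignReversal x := by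
  classical
  obtain ⟨k, rfl⟩ : ∃ k, m = k + k := hm
  let F : Fin (k + k) → Fin N := fun i => f i
  have hF : Function.Injective F := fun a b h => Fin.ext (hf a b a.2 b.2 h)
  let σ : Equiv.Perm (Fin N) := Fin.revPerm.extendDomain (Equiv.ofInjective F hF)
  have hσF : ∀ a < k + k, σ (f a) = f (k + k - 1 - a) := by
    intro a ha
    have := Equiv.Perm.extendDomain_apply_image Fin.revPerm (Equiv.ofInjective F hF) ⟨a, ha⟩
    simp only [Equiv.ofInjective_apply, Fin.revPerm_apply] at this
    refine this.trans ?_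
    simp only [F, Fin.val_rev]
    congr 1
    omega
  have hσ : ∀ p, p ∉ Set.range F → σ p = p := fun p hp =>
    Equiv.Perm.extendDomain_apply_not_subtype _ _ hp
  have hmem : ∀ a < k + k, f a ∈ Set.range F := fun a ha => ⟨⟨a, ha⟩, rfl⟩
  have hr1 : ∀ p, p ∉ Set.range F → x.1.1 p ∉ Set.range F := by
    rintro p hp ⟨a, ha⟩
    apply hp
    have := h1 a a.2
    change f a = _ at ha
    rw [ha, x.1.apply_apply] at this
    rw [this]
    exact hmem _ (by have := a.2; split_ifs <;> omega)
  have hr2 : ∀ p, p ∉ Set.range F → x.2.1 p ∉ Set.range F := by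
    rintro p hp ⟨a, ha⟩
    apply hp
    have := h2 a a.2
    change f a = _ at ha
    rw [ha, x.2.apply_apply] at this
    rw [this]
    exact hmem _ (by have := a.2; split_ifs <;> omega)
  have hc1 : Commute σ x.1.1 := by
    refine Equiv.Perm.ext fun p => ?_
    simp only [Equiv.Perm.mul_apply]
    by_cases hp : p ∈ Set.range F
    · obtain ⟨a, rfl⟩ := hp
      have ha := a.2
      change σ (x.1.1 (f a)) = x.1.1 (σ (f a))
      rw [h1 a ha, hσF a ha, h1 _ (by omega), hσF _ (by split_ifs <;> omega)]
      congr 1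
      split_ifs <;> omega
    · rw [hσ p hp, hσ _ (hr1 p hp)]
  have hc2 : Commute σ x.2.1 := by
    refine Equiv.Perm.ext fun p => ?_
    simp only [Equiv.Perm.mul_apply]
    by_cases hp : p ∈ Set.range F
    · obtain ⟨a, rfl⟩ := hp
      have ha := a.2
      change σ (x.2.1 (f a)) = x.2.1 (σ (f a))
      rw [h2 a ha, hσF a ha, h2 _ (by omega), hσF _ (by split_ifs <;> omega)]
      congr 1
      split_ifs <;> omega
    · rw [hσ p hp, hσ _ (hr2 p hp)]
  refine ⟨σ, hc1, hc2, ?_⟩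
  -- On the path the colour alternates, starting from `c`; off the path, where σ is the identity,
  -- the orientation given by the order serves.
  let s : Equiv.Perm (Fin N) → ℤ → Fin N → ℤ := fun τ c p =>
    if h : ∃ a : Fin (k + k), F a = p then c * (-1) ^ (h.choose : ℕ) else if p < τ p then 1 else -1
  have hsF : ∀ τ c, ∀ a < k + k, s τ c (f a) = c * (-1) ^ a := by
    intro τ c a ha
    have h : ∃ b : Fin (k + k), F b = f a := ⟨⟨a, ha⟩, rfl⟩
    have hb : (h.choose : ℕ) = a := hf _ _ h.choose.2 ha h.choose_spec
    simp only [s]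
    rw [dif_pos h, hb]
  have hsn : ∀ τ c p, p ∉ Set.range F → s τ c p = if p < τ p then 1 else -1 :=
    fun τ c p hp => dif_neg hp
  have hs : ∀ τ c, (c = 1 ∨ c = -1) → ∀ p, s τ c p = 1 ∨ s τ c p = -1 := by
    intro τ c hc p
    by_cases hp : p ∈ Set.range F
    · obtain ⟨a, rfl⟩ := hp
      change s τ c (f a) = 1 ∨ s τ c (f a) = -1
      rw [hsF _ _ _ a.2]
      rcases neg_one_pow_eq_or ℤ (a : ℕ) with h | h <;> rcases hc with h' | h' <;> simp [h, h']
    · rw [hsn _ _ _ hp]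
      split_ifs <;> simp
  have key : ∀ τ : Equiv.Perm (Fin N), (∀ p, τ (τ p) = p) → Commute σ τ → ∀ c : ℤ,
      (c = 1 ∨ c = -1) → (∀ p, τ p ≠ p → s τ c (τ p) = -s τ c p) →
      sgn σ τ = ∏ a : Fin (k + k), if c * (-1) ^ (a : ℕ) = 1 ∧ τ (f a) ≠ f a then -1 else 1 := by
    intro τ hτ hστ c hc hsτ
    rw [sgn_eq_prod_of_commute hτ hστ (hs τ c hc) hsτ, Finset.prod_filter]
    symm
    refine Fintype.prod_of_injective F hF _ _ ?_ ?_
    · intro p hp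
      split_ifs with h
      · rw [hσ p hp, h.1]
      · rfl
    · intro a
      change _ = if s τ c (f a) = 1 ∧ τ (f a) ≠ f a then s τ c (σ (f a)) else 1
      have ha := a.2
      rw [hσF a a.2, hsF _ _ _ a.2, hsF _ _ _ (by omega)]
      split_ifs with h
      · have h3 : ((-1 : ℤ)) ^ (k + k - 1 - (a : ℕ)) * (-1) ^ (a : ℕ) = -1 := by
          rw [← pow_add]
          exact Odd.neg_one_pow ⟨k - 1, by omega⟩
        have h4 : ((-1 : ℤ) ^ (a : ℕ)) * (-1) ^ (a : ℕ) = 1 := by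
          rw [← mul_pow]
          simp
        linear_combination (-(-1) ^ (k + k - 1 - (a : ℕ)) * (-1) ^ (a : ℕ)) * h.1 +
          c * (-1) ^ (k + k - 1 - (a : ℕ)) * h4 - h3
      · rfl
  have hout : ∀ (τ : Equiv.Perm (Fin N)) (c : ℤ), (∀ p, τ (τ p) = p) →
      (∀ p, p ∉ Set.range F → τ p ∉ Set.range F) →
      (∀ a < k + k, τ (f a) ≠ f a →
        ∃ b < k + k, τ (f a) = f b ∧ ((-1 : ℤ)) ^ b = - (-1) ^ a) →
      ∀ p, τ p ≠ p → s τ c (τ p) = -s τ c p := by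
    intro τ c hτ hr ha p hp
    by_cases hpr : p ∈ Set.range F
    · obtain ⟨a, rfl⟩ := hpr
      obtain ⟨b, hb, hb1, hb2⟩ := ha a a.2 hp
      change s τ c (τ (f a)) = -s τ c (f a)
      rw [hb1, hsF _ _ _ hb, hsF _ _ _ a.2, hb2]
      ring
    · rw [hsn _ _ _ hpr, hsn _ _ _ (hr p hpr), hτ]
      rcases lt_or_gt_of_ne hp with h | h <;> simp [h, h.not_gt]
  have hpow : ∀ a b : ℕ, b = a + 1 ∨ a = b + 1 → ((-1 : ℤ)) ^ b = - (-1) ^ a := by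
    rintro a b (rfl | rfl) <;> ring
  rw [key x.1.1 x.1.apply_apply hc1 1 (Or.inl rfl) (hout _ _ x.1.apply_apply hr1 ?_),
    key x.2.1 x.2.apply_apply hc2 (-1) (Or.inr rfl) (hout _ _ x.2.apply_apply hr2 ?_),
    ← Finset.prod_mul_distrib]
  -- With `c = 1` for the first involution and `c = -1` for the second, even positions count edges
  -- of the first and odd positions edges of the second. Only the last position `l` starts no edge,
  -- which leaves `l = 2k - 1` factors -1.
  · obtain ⟨l, hl⟩ : ∃ l, k + k = l + 1 := ⟨k + k - 1, by omega⟩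
    have hterm : ∀ a : Fin (k + k),
        ((if (1 : ℤ) * (-1) ^ (a : ℕ) = 1 ∧ x.1.1 (f a) ≠ f a then (-1 : ℤ) else 1) *
          if (-1 : ℤ) * (-1) ^ (a : ℕ) = 1 ∧ x.2.1 (f a) ≠ f a then (-1 : ℤ) else 1) =
        if (a : ℕ) = l then 1 else -1 := by
      intro a
      have ha := a.2
      have hne : ∀ b, b < k + k → (f b ≠ f a ↔ b ≠ a) := fun b hb =>
        not_congr ⟨fun h => hf _ _ hb ha h, fun h => by rw [h]⟩
      have g1 := hne (if (a : ℕ) % 2 = 0 then a + 1 else a - 1) (by split_ifs <;> omega)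
      have g2 := hne (if (a : ℕ) % 2 = 0 then a - 1 else if (a : ℕ) + 1 < k + k then a + 1 else a)
        (by split_ifs <;> omega)
      rw [← h1 a ha] at g1
      rw [← h2 a ha] at g2
      simp only [g1, g2]
      rcases Nat.even_or_odd (a : ℕ) with he | he
      · rw [he.neg_one_pow]
        have h3 : (a : ℕ) % 2 = 0 := Nat.even_iff.1 he
        have h4 : (a : ℕ) ≠ l := by omega
        simp [h3, h4]
      · rw [he.neg_one_pow]
        have h3 : (a : ℕ) % 2 = 1 := Nat.odd_iff.1 he
        by_cases h4 : (a : ℕ) = l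
        · have h5 : l % 2 = 1 := h4 ▸ h3
          have h6 : ¬ l + 1 < k + k := by omega
          simp [h4, h5, h6]
        · have h5 : (a : ℕ) + 1 < k + k := by omega
          simp [h3, h4, h5]
    rw [Finset.prod_congr rfl fun a _ => hterm a,
      Fin.prod_univ_eq_prod_range (fun a => if a = l then (1 : ℤ) else -1) (k + k), hl,
      Finset.prod_range_succ, if_pos rfl, mul_one, Finset.prod_congr rfl
        (fun a ha => if_neg (Finset.mem_range.1 ha).ne), Finset.prod_const, Finset.card_range]
    exact Odd.neg_one_pow ⟨k - 1, by omega⟩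
  · intro a ha hne
    rw [h2 a ha] at hne ⊢
    refine ⟨_, ?_, rfl, hpow _ _ ?_⟩
    · split_ifs <;> omega
    · split_ifs at hne ⊢
      -- Truncated subtraction gives `0 - 1 = 0`, which encodes that the left end is fixed.
      · have : a ≠ 0 := by rintro rfl; exact hne rfl
        omega
      · omega
      · exact absurd rfl hne
  · intro a ha hne
    rw [h1 a ha]
    refine ⟨_, ?_, rfl, hpow _ _ ?_⟩ <;> split_ifs <;> omega

/-! ### Alternating walks -/

/-- A walk along alternating edges of `t` and `k`: the edge from `2 i` to `2 i + 1` is a `t`-edge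
and the edge from `2 i - 1` to `2 i` is a `k`-edge. -/
structure IsWalk {α : Type*} (t k : α → α) (w : ℤ → α) : Prop where
  even_left : ∀ a, Even a → t (w a) = w (a + 1)
  even_right : ∀ a, Even a → k (w a) = w (a - 1)
  odd_left : ∀ a, Odd a → t (w a) = w (a - 1)
  odd_right : ∀ a, Odd a → k (w a) = w (a + 1)

/-- Even positions are the orbit of `p` under powers of `k * t`, and odd positions are their images
under `t`. -/
theorem exists_isWalk {α : Type*} {t k : Equiv.Perm α} (ht : ∀ p, t (t p) = p)
    (hk : ∀ p, k (k p) = p) (p : α) : ∃ w : ℤ → α, IsWalk t k w ∧ w 0 = p := by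
  let w : ℤ → α := fun a =>
    if Even a then ((k * t) ^ (a / 2)) p else t (((k * t) ^ (a / 2)) p)
  have he : ∀ i, w (2 * i) = ((k * t) ^ i) p := by
    intro i
    simp [w]
  have ho : ∀ i, w (2 * i + 1) = t (((k * t) ^ i) p) := by
    intro i
    have h1 : ¬ Even (2 * i + 1) := by simp
    have h2 : (2 * i + 1) / 2 = i := by omega
    simp only [w, if_neg h1, h2]
  have hk2 : ∀ i, k (w (2 * i)) = w (2 * i - 1) := by
    intro i
    obtain ⟨l, rfl⟩ : ∃ l, i = 1 + l := ⟨i - 1, by ring⟩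
    rw [show 2 * (1 + l) - 1 = 2 * l + 1 by ring, he, ho, zpow_add, zpow_one]
    simp [hk]
  refine ⟨w, ⟨?_, ?_, ?_, ?_⟩, ?_⟩
  · rintro a ⟨i, rfl⟩
    rw [← two_mul, he, ho]
  · rintro a ⟨i, rfl⟩
    rw [← two_mul, hk2]
  · rintro a ⟨i, rfl⟩
    rw [ho, ht, add_sub_cancel_right, he]
  · rintro a ⟨i, rfl⟩
    rw [show 2 * i + 1 + 1 = 2 * (i + 1) by ring, show 2 * i + 1 = 2 * (i + 1) - 1 by ring,
      ← hk2, hk]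
  · have := he 0
    simpa using this

namespace IsWalk

variable {α : Type*} {t k : α → α} {w : ℤ → α}

/-- At positions of equal parity the two continuations use the same involution, so a coincidence
propagates by translation. -/
theorem apply_add (hw : IsWalk t k w) {a b : ℤ} (hab : Even (a - b)) (h : w a = w b) (c : ℤ) :
    w (a + c) = w (b + c) := by
  have step : ∀ {a b : ℤ}, Even (a - b) → w a = w b →
      w (a + 1) = w (b + 1) ∧ w (a - 1) = w (b - 1) := by
    intro a b hab h
    rcases Int.even_or_odd a with ha | ha
    · have hb : Even b := by simpa using ha.sub hab
      rw [← hw.even_left a ha, ← hw.even_left b hb, ← hw.even_right a ha, ← hw.even_right b hb, h]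
      exact ⟨rfl, rfl⟩
    · have hb : Odd b := by simpa using ha.sub_even hab
      rw [← hw.odd_left a ha, ← hw.odd_left b hb, ← hw.odd_right a ha, ← hw.odd_right b hb, h]
      exact ⟨rfl, rfl⟩
  induction c using Int.induction_on with
  | zero => simpa using h
  | succ n ih =>
    have := (step (by simpa using hab) ih).1
    simpa [add_assoc] using this
  | pred n ih =>
    have := (step (by simpa using hab) ih).2
    simpa [add_sub_assoc] using this

/-- At positions of opposite parity the roles of the involutions are exchanged, so a coincidence
propagates by reflection. -/
theorem apply_add_sub (hw : IsWalk t k w) {a b : ℤ} (hab : Odd (a - b)) (h : w a = w b) (c : ℤ) :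
    w (a + c) = w (b - c) := by
  have step : ∀ {a b : ℤ}, Odd (a - b) → w a = w b →
      w (a + 1) = w (b - 1) ∧ w (a - 1) = w (b + 1) := by
    intro a b hab h
    rcases Int.even_or_odd a with ha | ha
    · have hb : Odd b := by simpa using ha.sub_odd hab
      rw [← hw.even_left a ha, ← hw.odd_left b hb, ← hw.even_right a ha, ← hw.odd_right b hb, h]
      exact ⟨rfl, rfl⟩
    · have hb : Even b := by simpa using ha.sub_odd hab
      rw [← hw.odd_left a ha, ← hw.even_left b hb, ← hw.odd_right a ha, ← hw.even_right b hb, h]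
      exact ⟨rfl, rfl⟩
  induction c using Int.induction_on with
  | zero => simpa using h
  | succ n ih =>
    have hodd : Odd (a + n - (b - n)) := by
      rw [show a + n - (b - n) = (a - b) + 2 * (n : ℤ) by ring]
      exact hab.add_even (even_two_mul _)
    have := (step hodd ih).1
    rw [← add_assoc, this]
    congr 1
    ring
  | pred n ih =>
    have hodd : Odd (a + -n - (b - -n)) := by
      rw [show a + -n - (b - -n) = (a - b) + 2 * (-(n : ℤ)) by ring]
      exact hab.add_even (even_two_mul _)
    have := (step hodd ih).2
    rw [← add_sub_assoc, this]
    congr 1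
    ring

/-- A walk in a finite set has a least even period, and below it positions of equal parity are
distinct. -/
theorem exists_period [Finite α] (hw : IsWalk t k w) :
    ∃ m : ℕ, 0 < m ∧ (∀ a, w (a + 2 * m) = w a) ∧
      ∀ a b : ℤ, Even (a - b) → w a = w b → |a - b| < 2 * m → a = b := by
  classical
  -- Pigeonhole on even positions, then translation to 0.
  have hex : ∃ m : ℕ, 0 < m ∧ w (2 * m) = w 0 := by
    obtain ⟨a, b, hab, h⟩ := Finite.exists_ne_map_eq_of_infinite fun n : ℕ => w (2 * n)
    wlog hlt : a < b generalizing a b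
    · exact this b a hab.symm h.symm (lt_of_le_of_ne (not_lt.1 hlt) hab.symm)
    refine ⟨b - a, by omega, ?_⟩
    have h1 := hw.apply_add (a := 2 * (b : ℤ)) (b := 2 * a)
      ((even_two_mul _).sub (even_two_mul _)) h.symm (-(2 * a))
    rw [Nat.cast_sub hlt.le]
    convert h1 using 2 <;> ring
  have hspec := Nat.find_spec hex
  have hmin := fun l => Nat.find_min hex (m := l)
  generalize Nat.find hex = m at hspec hmin
  refine ⟨m, hspec.1, ?_, ?_⟩
  · intro a
    have := hw.apply_add (by simp) hspec.2 a
    rwa [zero_add, add_comm] at this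
  · intro a b hev h hlt
    wlog hab : b ≤ a generalizing a b
    · exact (this b a (by rw [← neg_sub]; exact hev.neg) h.symm (by rwa [abs_sub_comm])
        (not_le.1 hab).le).symm
    obtain ⟨c, hc⟩ := hev
    rw [abs_of_nonneg (by omega)] at hlt
    by_contra hne
    obtain ⟨l, rfl⟩ : ∃ l : ℕ, c = l := ⟨c.toNat, by omega⟩
    refine hmin l (by omega) ⟨by omega, ?_⟩
    have h1 := hw.apply_add (a := a) (b := b) ⟨l, hc⟩ h (-b)
    convert h1 using 2
    · omega
    · ring

theorem neg_one_sub (hw : IsWalk t k w) (h : k (w 0) = w 0) (a : ℤ) : w (-1 - a) = w a := by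
  rw [hw.even_right 0 (by simp)] at h
  have := hw.apply_add_sub (a := 0) (b := -1) (by simp) (by simpa using h.symm) a
  rw [← this, zero_add]

/-- A walk starting at a `k`-fixed point runs along a path. -/
theorem exists_path [Finite α] (hw : IsWalk t k w) (h0 : k (w 0) = w 0) :
    ∃ m : ℕ, 0 < m ∧ (∀ a b : ℕ, a < m → b < m → w a = w b → a = b) ∧
      (∀ a < m, t (w a) =
        w ((if a % 2 = 0 then if a + 1 < m then a + 1 else a else a - 1 : ℕ) : ℤ)) ∧
      (∀ a < m, k (w a) =
        w ((if a % 2 = 0 then a - 1 else if a + 1 < m then a + 1 else a : ℕ) : ℤ)) := by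
  obtain ⟨m, hm0, hper, hinj⟩ := hw.exists_period
  have hneg := hw.neg_one_sub h0
  have hlast : w m = w (m - 1) := by
    have := hper (-1 - (m - 1))
    rw [hneg] at this
    rw [← this]
    congr 1
    ring
  -- The reflection about -1/2 combined with the period gives a second mirror at m - 1/2, the other
  -- end of the path. It also turns coincidences of opposite parity into ones of equal parity.
  have hmir : ∀ a : ℤ, w a = w (2 * m - 1 - a) := by
    intro a
    rw [← hneg a, ← hper]
    congr 1
    ring
  refine ⟨m, hm0, ?_, ?_, ?_⟩
  · intro a b ha hb h
    rcases Int.even_or_odd ((a : ℤ) - b) with he | ho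
    · have := hinj a b he h (abs_lt.2 ⟨by omega, by omega⟩)
      exact_mod_cast this
    · rw [hmir b] at h
      have := hinj a (2 * m - 1 - b) ?_ h (abs_lt.2 ⟨by omega, by omega⟩)
      · omega
      · obtain ⟨c, hc⟩ := ho
        exact ⟨c + 1 - m + b, by linear_combination hc⟩
  · intro a ha
    by_cases h2 : a % 2 = 0
    · rw [hw.even_left a (by exact_mod_cast Nat.even_iff.2 h2), if_pos h2]
      split_ifs with h
      · push_cast; rfl
      · obtain rfl : m = a + 1 := by omega
        push_cast at hlast
        rw [hlast]
        congr 1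
        ring
    · rw [hw.odd_left a (by exact_mod_cast Nat.odd_iff.2 (Nat.mod_two_ne_zero.1 h2)), if_neg h2]
      congr 1
      omega
  · intro a ha
    by_cases h2 : a % 2 = 0
    · rw [hw.even_right a (by exact_mod_cast Nat.even_iff.2 h2), if_pos h2]
      rcases Nat.eq_zero_or_pos a with rfl | h
      · have := hneg 0
        simpa using this
      · congr 1
        omega
    · rw [hw.odd_right a (by exact_mod_cast Nat.odd_iff.2 (Nat.mod_two_ne_zero.1 h2)), if_neg h2]
      split_ifs with h
      · push_cast; rfl
      · obtain rfl : m = a + 1 := by omega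
        push_cast at hlast
        rw [hlast]
        congr 1
        ring

/-- A walk that meets no fixed points runs along a cycle. -/
theorem exists_cycle [Finite α] (hw : IsWalk t k w) (h0 : ∀ a, k (w a) ≠ w a)
    (h1 : ∀ a, t (w a) ≠ w a) :
    ∃ n : ℕ, 0 < n ∧ n % 2 = 0 ∧ (∀ a b : ℕ, a < n → b < n → w a = w b → a = b) ∧
      (∀ a < n, t (w a) = w ((if a % 2 = 0 then a + 1 else a - 1 : ℕ) : ℤ)) ∧
      (∀ a < n, k (w a) = w ((if a % 2 = 0 then if a = 0 then n - 1 else a - 1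
        else if a + 1 < n then a + 1 else 0 : ℕ) : ℤ)) := by
  obtain ⟨m, hm0, hper, hinj⟩ := hw.exists_period
  -- A coincidence of opposite parity would reflect the walk, and the two adjacent positions at the
  -- centre would coincide: a fixed point.
  have hodd : ∀ a b : ℤ, Odd (a - b) → w a ≠ w b := by
    rintro a b ⟨c, hc⟩ h
    have h2 := hw.apply_add_sub ⟨c, hc⟩ h (-c)
    rw [show a + -c = b + c + 1 by linear_combination hc, show b - -c = b + c by ring] at h2
    rcases Int.even_or_odd (b + c) with he | ho
    · exact h1 (b + c) (by rw [hw.even_left _ he, h2])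
    · exact h0 (b + c) (by rw [hw.odd_right _ ho, h2])
  refine ⟨2 * m, by omega, by omega, ?_, ?_, ?_⟩
  · intro a b ha hb h
    rcases Int.even_or_odd ((a : ℤ) - b) with he | ho
    · have := hinj a b he h (abs_lt.2 ⟨by omega, by omega⟩)
      exact_mod_cast this
    · exact absurd h (hodd _ _ ho)
  · intro a ha
    by_cases h2 : a % 2 = 0
    · rw [hw.even_left a (by exact_mod_cast Nat.even_iff.2 h2), if_pos h2]
      push_cast; rfl
    · rw [hw.odd_left a (by exact_mod_cast Nat.odd_iff.2 (Nat.mod_two_ne_zero.1 h2)), if_neg h2]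
      congr 1
      omega
  · intro a ha
    by_cases h2 : a % 2 = 0
    · rw [hw.even_right a (by exact_mod_cast Nat.even_iff.2 h2), if_pos h2]
      split_ifs with h
      · subst h
        rw [← hper]
        congr 1
        omega
      · congr 1
        omega
    · rw [hw.odd_right a (by exact_mod_cast Nat.odd_iff.2 (Nat.mod_two_ne_zero.1 h2)), if_neg h2]
      split_ifs with h
      · push_cast; rfl
      · have := hper 0
        rw [zero_add] at this
        rw [Nat.cast_zero, ← this]
        congr 1
        omega

end IsWalk

/-! ### Blocks and standard pairs -/

theorem charSetoid_left (τ κ : Equiv.Perm (Fin N)) (p : Fin N) : charSetoid τ κ p (τ p) :=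
  fun _ hr => (hr p).1

theorem charSetoid_right (τ κ : Equiv.Perm (Fin N)) (p : Fin N) : charSetoid τ κ p (κ p) :=
  fun _ hr => (hr p).2

theorem charSetoid_le {τ κ : Equiv.Perm (Fin N)} {r : Setoid (Fin N)}
    (h1 : ∀ p, r p (τ p)) (h2 : ∀ p, r p (κ p)) : charSetoid τ κ ≤ r :=
  sInf_le fun p => ⟨h1 p, h2 p⟩

theorem IsWalk.rel {α : Type*} {t k : α → α} {w : ℤ → α} (hw : IsWalk t k w) (r : Setoid α)
    (ht : ∀ p, r p (t p)) (hk : ∀ p, r p (k p)) (a : ℤ) : r (w 0) (w a) := by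
  induction a using Int.induction_on with
  | zero => exact r.refl' _
  | succ n ih =>
    refine r.trans' ih ?_
    rcases Int.even_or_odd (n : ℤ) with h | h
    · rw [← hw.even_left _ h]; exact ht _
    · rw [← hw.odd_right _ h]; exact hk _
  | pred n ih =>
    refine r.trans' ih ?_
    rcases Int.even_or_odd (-n : ℤ) with h | h
    · rw [← hw.even_right _ h]; exact hk _
    · rw [← hw.odd_left _ h]; exact ht _

/-- The first involution of the standard pair on `n` points. -/
def stdLeft {n : ℕ} (i : Fin n) : Fin n :=
  ⟨if (i : ℕ) % 2 = 0 then if (i : ℕ) + 1 < n then i + 1 else i else i - 1, by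
    have := i.2
    split_ifs <;> omega⟩

/-- The second involution of the standard pair on `n` points. Together with `stdLeft` it forms a
path if `n` is odd and a cycle if `n` is even. -/
def stdRight {n : ℕ} (i : Fin n) : Fin n :=
  ⟨if (i : ℕ) % 2 = 0 then if (i : ℕ) = 0 then if n % 2 = 0 then n - 1 else 0 else i - 1
    else if (i : ℕ) + 1 < n then i + 1 else 0, by
    have := i.2
    split_ifs <;> omega⟩

theorem stdLeft_stdLeft {n : ℕ} (i : Fin n) : stdLeft (stdLeft i) = i := by
  have := i.2
  apply Fin.ext
  simp only [stdLeft]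
  split_ifs <;> omega

theorem stdRight_stdRight {n : ℕ} (i : Fin n) : stdRight (stdRight i) = i := by
  have hi := i.2
  obtain ⟨a, ha⟩ : ∃ a, a = ((stdRight i : Fin n) : ℕ) := ⟨_, rfl⟩
  have h : ((stdRight (stdRight i) : Fin n) : ℕ) =
      if a % 2 = 0 then if a = 0 then if n % 2 = 0 then n - 1 else 0 else a - 1
        else if a + 1 < n then a + 1 else 0 := by
    rw [ha]
    rfl
  apply Fin.ext
  rw [h]
  simp only [stdRight] at ha
  split_ifs at ha <;> split_ifs <;> omega

/-- For odd n the two involutions fix opposite ends of the path, both at even positions; this is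
what allows a colouring by parity to be 1 at every fixed point. -/
theorem stdLeft_eq_self_iff {n : ℕ} (i : Fin n) :
    stdLeft i = i ↔ n % 2 = 1 ∧ (i : ℕ) = n - 1 := by
  have := i.2
  rw [Fin.ext_iff]
  simp only [stdLeft]
  split_ifs <;> omega

theorem stdRight_eq_self_iff {n : ℕ} (i : Fin n) :
    stdRight i = i ↔ n % 2 = 1 ∧ (i : ℕ) = 0 := by
  have := i.2
  rw [Fin.ext_iff]
  simp only [stdRight]
  split_ifs <;> omega

theorem stdLeft_add_odd {n : ℕ} {i : Fin n} (h : stdLeft i ≠ i) :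
    ((stdLeft i : ℕ) + i) % 2 = 1 := by
  have := i.2
  rw [Ne, Fin.ext_iff] at h
  simp only [stdLeft] at h ⊢
  split_ifs at h ⊢ <;> omega

theorem stdRight_add_odd {n : ℕ} {i : Fin n} (h : stdRight i ≠ i) :
    ((stdRight i : ℕ) + i) % 2 = 1 := by
  have := i.2
  rw [Ne, Fin.ext_iff] at h
  simp only [stdRight] at h ⊢
  split_ifs at h ⊢ <;> omega

/-- In a pair without sign reversal, every block is isomorphic to a standard pair. -/
theorem exists_standard_block {x : Invol N j × Invol N j} (hx : ¬ HasSignReversal x)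
    (q : Fin N) : ∃ (n : ℕ) (f : Fin n → Fin N), 0 < n ∧ Function.Injective f ∧
      (∀ i, x.1.1 (f i) = f (stdLeft i)) ∧ (∀ i, x.2.1 (f i) = f (stdRight i)) ∧
      ∃ i, charSetoid x.1.1 x.2.1 q (f i) := by
  by_cases hA : ∃ p, charSetoid x.1.1 x.2.1 q p ∧ x.2.1 p = p
  · obtain ⟨p, hqp, hp⟩ := hA
    obtain ⟨w, hw, rfl⟩ := exists_isWalk x.1.apply_apply x.2.apply_apply p
    obtain ⟨m, hm0, hinj, h1, h2⟩ := hw.exists_path hp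
    rcases Nat.even_or_odd m with hm | hm
    · refine absurd (hasSignReversal_of_even_path hm hm0 (f := fun a : ℕ => w a) hinj ?_ h2) hx
      intro a ha
      rw [h1 a ha]
      have := Nat.even_iff.1 hm
      congr 2
      split_ifs <;> omega
    · have hm' := Nat.odd_iff.1 hm
      refine ⟨m, fun i => w ((i : ℕ) : ℤ), hm0, fun a b h => Fin.ext (hinj a b a.2 b.2 h),
        fun i => h1 i i.2, fun i => ?_, ⟨0, hm0⟩, hqp⟩
      have hi := i.2
      rw [h2 i i.2]
      simp only [stdRight]
      congr 2
      split_ifs <;> omega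
  by_cases hB : ∃ p, charSetoid x.1.1 x.2.1 q p ∧ x.1.1 p = p
  · obtain ⟨p, hqp, hp⟩ := hB
    obtain ⟨w, hw, rfl⟩ := exists_isWalk x.2.apply_apply x.1.apply_apply p
    obtain ⟨m, hm0, hinj, h1, h2⟩ := hw.exists_path hp
    rcases Nat.even_or_odd m with hm | hm
    · refine absurd (hasSignReversal_of_even_path (x := x.swap) hm hm0
        (f := fun a : ℕ => w a) hinj ?_ h2).swap hx
      intro a ha
      refine (h1 a ha).trans ?_
      have := Nat.even_iff.1 hm
      congr 2
      split_ifs <;> omega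
    · have hm' := Nat.odd_iff.1 hm
      -- An odd path starting at a fixed point of the first involution ends at one of the second, so
      -- the previous case applies.
      refine absurd ⟨w ((m - 1 : ℕ) : ℤ), (charSetoid x.1.1 x.2.1).trans' hqp
        (hw.rel _ (charSetoid_right _ _) (charSetoid_left _ _) _), ?_⟩ hA
      rw [h1 (m - 1) (by omega)]
      congr 2
      split_ifs <;> omega
  obtain ⟨w, hw, rfl⟩ := exists_isWalk x.1.apply_apply x.2.apply_apply q
  have hrel := hw.rel _ (charSetoid_left x.1.1 x.2.1) (charSetoid_right x.1.1 x.2.1)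
  obtain ⟨n, hn0, hn2, hinj, h1, h2⟩ := hw.exists_cycle
    (fun a h => hA ⟨w a, hrel a, h⟩) (fun a h => hB ⟨w a, hrel a, h⟩)
  refine ⟨n, fun i => w ((i : ℕ) : ℤ), hn0, fun a b h => Fin.ext (hinj a b a.2 b.2 h),
    fun i => ?_, fun i => ?_, ⟨0, hn0⟩, hrel 0⟩
  · have hi := i.2
    rw [h1 i i.2]
    simp only [stdLeft]
    congr 2
    split_ifs <;> omega
  · have hi := i.2
    rw [h2 i i.2]
    simp only [stdRight]
    congr 2
    split_ifs <;> omega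

/-- `e` identifies a pair of permutations with a disjoint union of standard pairs. -/
structure IsStandardForm (τ κ : Equiv.Perm (Fin N)) {ι : Type} {s : ι → ℕ}
    (e : (Σ b, Fin (s b)) ≃ Fin N) : Prop where
  left : ∀ b i, τ (e ⟨b, i⟩) = e ⟨b, stdLeft i⟩
  right : ∀ b i, κ (e ⟨b, i⟩) = e ⟨b, stdRight i⟩

/-- A relation compatible with a standard pair is total. -/
theorem rel_of_standard {α : Type*} {n : ℕ} {f : Fin n → α} (r : Setoid α)
    (h1 : ∀ i, r (f i) (f (stdLeft i))) (h2 : ∀ i, r (f i) (f (stdRight i))) (a b : Fin n) :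
    r (f a) (f b) := by
  have h0 : ∀ (i : ℕ) (hi : i < n), r (f ⟨i, hi⟩) (f ⟨0, by omega⟩) := by
    intro i
    induction i with
    | zero => exact fun _ => r.refl' _
    | succ i ih =>
      intro hi
      refine r.trans' ?_ (ih (by omega))
      -- Consecutive positions are joined by `stdRight` or `stdLeft`, according to the parity of the
      -- larger one.
      rcases Nat.even_or_odd (i + 1) with h | h
      · have h' := Nat.even_iff.1 h
        have : (⟨i, by omega⟩ : Fin n) = stdRight ⟨i + 1, hi⟩ := by
          apply Fin.ext
          simp [stdRight, h']
        rw [this]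
        exact h2 _
      · have h' := Nat.odd_iff.1 h
        have : (⟨i, by omega⟩ : Fin n) = stdLeft ⟨i + 1, hi⟩ := by
          apply Fin.ext
          simp [stdLeft, h']
        rw [this]
        exact h1 _
  exact r.trans' (h0 a a.2) (r.symm' (h0 b b.2))

theorem IsStandardForm.charSetoid_iff {τ κ : Equiv.Perm (Fin N)} {ι : Type} {s : ι → ℕ}
    {e : (Σ b, Fin (s b)) ≃ Fin N} (h : IsStandardForm τ κ e) (p q : Fin N) :
    charSetoid τ κ p q ↔ (e.symm p).1 = (e.symm q).1 := by
  constructor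
  · have hle : charSetoid τ κ ≤ Setoid.ker fun p => (e.symm p).1 := by
      refine charSetoid_le ?_ ?_
      · intro p
        obtain ⟨⟨b, i⟩, rfl⟩ := e.surjective p
        rw [h.left, Setoid.ker_def]
        simp
      · intro p
        obtain ⟨⟨b, i⟩, rfl⟩ := e.surjective p
        rw [h.right, Setoid.ker_def]
        simp
    exact fun hpq => hle hpq
  · intro hpq
    obtain ⟨⟨b, i⟩, rfl⟩ := e.surjective p
    obtain ⟨⟨b', i'⟩, rfl⟩ := e.surjective q
    simp only [Equiv.symm_apply_apply] at hpq
    subst hpq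
    refine rel_of_standard (f := fun i => e ⟨b, i⟩) (charSetoid τ κ) ?_ ?_ i i'
    · intro a
      simp only [← h.left]
      exact charSetoid_left _ _ _
    · intro a
      simp only [← h.right]
      exact charSetoid_right _ _ _

theorem IsStandardForm.numPartition_parts {τ κ : Equiv.Perm (Fin N)} {ι : Type} [Fintype ι]
    {s : ι → ℕ} {e : (Σ b, Fin (s b)) ≃ Fin N} (h : IsStandardForm τ κ e) (hs : ∀ b, 0 < s b) :
    (numPartition τ κ).parts = Finset.univ.val.map s := by
  classical
  let F : ι → Finset (Fin N) := fun b =>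
    Finset.univ.map ((Function.Embedding.sigmaMk b).trans e.toEmbedding)
  have hF : ∀ b p, p ∈ F b ↔ (e.symm p).1 = b := by
    intro b p
    obtain ⟨⟨b', i⟩, rfl⟩ := e.surjective p
    simp only [F, Finset.mem_map, Finset.mem_univ, true_and, Function.Embedding.trans_apply,
      Equiv.coe_toEmbedding, EmbeddingLike.apply_eq_iff_eq, Equiv.symm_apply_apply,
      Function.Embedding.sigmaMk_apply]
    constructor
    · rintro ⟨a, ha⟩
      exact (congrArg Sigma.fst ha).symm
    · rintro rfl
      exact ⟨i, rfl⟩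
  have hFinj : Function.Injective F := by
    intro b b' hbb
    have h1 : e ⟨b, ⟨0, hs b⟩⟩ ∈ F b := (hF _ _).2 (by simp)
    rw [hbb, hF] at h1
    simpa using h1
  have hparts : (Finpartition.ofSetoid (charSetoid τ κ)).parts = Finset.univ.image F := by
    change (Finpartition.ofSetSetoid (charSetoid τ κ) Finset.univ).parts = _
    rw [Finpartition.ofSetSetoid_parts]
    ext B
    simp only [Finset.mem_image, Finset.mem_univ, true_and]
    constructor
    · rintro ⟨p, rfl⟩
      refine ⟨(e.symm p).1, ?_⟩
      ext q
      rw [hF, Finset.mem_filter]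
      exact ⟨fun hq => ⟨Finset.mem_univ _, (h.charSetoid_iff p q).2 hq.symm⟩,
        fun hq => ((h.charSetoid_iff p q).1 hq.2).symm⟩
    · rintro ⟨b, rfl⟩
      refine ⟨e ⟨b, ⟨0, hs b⟩⟩, ?_⟩
      ext q
      rw [hF, Finset.mem_filter]
      have := h.charSetoid_iff (e ⟨b, ⟨0, hs b⟩⟩) q
      rw [Equiv.symm_apply_apply] at this
      exact ⟨fun hq => (this.1 hq.2).symm, fun hq => ⟨Finset.mem_univ _, this.2 hq.symm⟩⟩
  change (Finpartition.ofSetoid (charSetoid τ κ)).parts.val.map Finset.card = _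
  rw [hparts, Finset.image_val_of_injOn hFinj.injOn, Multiset.map_map]
  refine Multiset.map_congr rfl fun b _ => ?_
  simp [F]

/-- A pair without sign reversal is a disjoint union of standard pairs. -/
theorem exists_isStandardForm {x : Invol N j × Invol N j} (hx : ¬ HasSignReversal x) :
    ∃ (ι : Type) (_ : Fintype ι) (s : ι → ℕ) (e : (Σ b, Fin (s b)) ≃ Fin N),
      (∀ b, 0 < s b) ∧ IsStandardForm x.1.1 x.2.1 e := by
  classical
  set r := charSetoid x.1.1 x.2.1 with hr
  have hex : ∀ b : Quotient r, ∃ (n : ℕ) (f : Fin n → Fin N), 0 < n ∧ Function.Injective f ∧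
      (∀ i, x.1.1 (f i) = f (stdLeft i)) ∧ (∀ i, x.2.1 (f i) = f (stdRight i)) ∧
      ∃ i, b = Quotient.mk r (f i) := by
    intro b
    induction b using Quotient.inductionOn with
    | h q =>
      obtain ⟨n, f, h0, h1, h2, h3, i, hi⟩ := exists_standard_block hx q
      exact ⟨n, f, h0, h1, h2, h3, i, Quotient.sound hi⟩
  choose s f hs hinj h1 h2 i₀ hi₀ using hex
  have hclass : ∀ b i, Quotient.mk r (f b i) = b := by
    intro b i
    refine Eq.trans ?_ (hi₀ b).symm
    refine Quotient.sound (rel_of_standard r ?_ ?_ _ _)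
    · intro a
      rw [← h1]
      exact charSetoid_left _ _ _
    · intro a
      rw [← h2]
      exact charSetoid_right _ _ _
  have hbij : Function.Bijective fun z : Σ b, Fin (s b) => f z.1 z.2 := by
    constructor
    · rintro ⟨b, i⟩ ⟨b', i'⟩ h
      simp only at h
      obtain rfl : b = b' := by rw [← hclass b i, h, hclass]
      rw [hinj b h]
    · intro p
      -- The classes of `R` are the image of the standard block and its complement. Both involutions
      -- preserve the image, so `R` is coarser than the characteristic partition and the image
      -- contains the whole block of `p`.
      let R : Setoid (Fin N) :=
        Setoid.ker fun q => ∃ i, f (Quotient.mk r p) i = q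
      have hinv : ∀ (t : Fin N → Fin N), (∀ q, t (t q) = q) →
          (∀ i, ∃ i', t (f (Quotient.mk r p) i) = f (Quotient.mk r p) i') → ∀ q, R q (t q) := by
        intro t ht htf q
        rw [Setoid.ker_def]
        refine propext ⟨?_, ?_⟩
        · rintro ⟨i, rfl⟩
          obtain ⟨i', hi'⟩ := htf i
          exact ⟨i', hi'.symm⟩
        · rintro ⟨i, hi⟩
          obtain ⟨i', hi'⟩ := htf i
          exact ⟨i', by rw [← hi', hi, ht]⟩
      have hle : r ≤ R := charSetoid_le
        (hinv _ x.1.apply_apply fun i => ⟨_, h1 _ i⟩) (hinv _ x.2.apply_apply fun i => ⟨_, h2 _ i⟩)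
      have hrel : R p (f (Quotient.mk r p) (i₀ (Quotient.mk r p))) :=
        hle (Quotient.exact (hi₀ (Quotient.mk r p)))
      rw [Setoid.ker_def] at hrel
      obtain ⟨i, hi⟩ := hrel.mpr ⟨_, rfl⟩
      exact ⟨⟨_, i⟩, hi⟩
  exact ⟨Quotient r, inferInstance, s, Equiv.ofBijective _ hbij, hs, ⟨h1, h2⟩⟩

/-- Colour each point by the parity of its position in its block. -/
theorem IsStandardForm.not_hasSignReversal {x : Invol N j × Invol N j} {ι : Type} {s : ι → ℕ}
    {e : (Σ b, Fin (s b)) ≃ Fin N} (h : IsStandardForm x.1.1 x.2.1 e) : ¬ HasSignReversal x := by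
  have hpow : ∀ a b : ℕ, (a + b) % 2 = 1 → (-1 : ℤ) ^ a = -(-1) ^ b := by
    intro a b hab
    rcases Nat.even_or_odd b with hb | hb
    · rw [hb.neg_one_pow, Odd.neg_one_pow (Nat.odd_iff.2 (by have := Nat.even_iff.1 hb; omega))]
    · rw [hb.neg_one_pow, Even.neg_one_pow (Nat.even_iff.2 (by have := Nat.odd_iff.1 hb; omega)),
        neg_neg]
  obtain ⟨c, hc⟩ : ∃ c : (Σ b, Fin (s b)) → ℤ, ∀ b i, c ⟨b, i⟩ = (-1) ^ (i : ℕ) :=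
    ⟨fun z => (-1) ^ (z.2 : ℕ), fun _ _ => rfl⟩
  refine not_hasSignReversal_of_coloring (s := fun p => c (e.symm p)) ?_ ?_ ?_ ?_ ?_ <;>
    intro p <;> obtain ⟨⟨b, i⟩, rfl⟩ := e.surjective p <;>
    simp only [h.left, h.right, Equiv.symm_apply_apply, ne_eq, EmbeddingLike.apply_eq_iff_eq,
      Sigma.mk.injEq, heq_eq_eq, true_and, hc]
  · exact neg_one_pow_eq_or ℤ _
  · exact fun hne => hpow _ _ (stdLeft_add_odd hne)
  · exact fun hne => hpow _ _ (stdRight_add_odd hne)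
  · intro hi
    obtain ⟨h3, h4⟩ := (stdLeft_eq_self_iff i).1 hi
    exact Even.neg_one_pow (Nat.even_iff.2 (by omega))
  · intro hi
    obtain ⟨h3, h4⟩ := (stdRight_eq_self_iff i).1 hi
    simp [h4]

/-! ### Classification and counting -/

/-- Two families of numbers with the same multiset of values agree up to reindexing. -/
theorem exists_equiv_of_map_eq {ι ι' β : Type*} [Fintype ι] [Fintype ι'] {s : ι → β}
    {s' : ι' → β} (h : Finset.univ.val.map s = Finset.univ.val.map s') :
    ∃ ε : ι ≃ ι', s = s' ∘ ε := by
  classical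
  -- Each fibre has as many elements as the multiplicity of its value in the common multiset.
  have hc : ∀ c, Nonempty ({a // s a = c} ≃ {b // s' b = c}) := by
    intro c
    refine ⟨Fintype.equivOfCardEq ?_⟩
    have := congrArg (Multiset.count c) h
    rw [Multiset.count_map, Multiset.count_map] at this
    rw [Fintype.card_subtype, Fintype.card_subtype, Finset.card_def, Finset.card_def,
      Finset.filter_val, Finset.filter_val]
    simpa only [eq_comm] using this
  exact ⟨Equiv.ofFiberEquiv fun c => (hc c).some,
    funext fun a => (Equiv.ofFiberEquiv_map (fun c => (hc c).some) a).symm⟩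

/-- Matching blocks of equal size position by position intertwines both involutions at once. -/
theorem IsStandardForm.exists_smul_eq {x y : Invol N j × Invol N j} {ι ι' : Type} [Fintype ι]
    [Fintype ι'] {s : ι → ℕ} {s' : ι' → ℕ} {e : (Σ b, Fin (s b)) ≃ Fin N}
    {e' : (Σ b, Fin (s' b)) ≃ Fin N} (hx : IsStandardForm x.1.1 x.2.1 e)
    (hy : IsStandardForm y.1.1 y.2.1 e')
    (h : Finset.univ.val.map s = Finset.univ.val.map s') :
    ∃ σ : Equiv.Perm (Fin N), σ • x = y := by
  obtain ⟨ε, rfl⟩ := exists_equiv_of_map_eq h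
  let σ : Equiv.Perm (Fin N) :=
    (e.symm.trans (Equiv.sigmaCongrLeft (β := fun b => Fin (s' b)) ε)).trans e'
  have hσ : ∀ b i, σ (e ⟨b, i⟩) = e' ⟨ε b, i⟩ := by
    intro b i
    simp [σ, Equiv.sigmaCongrLeft]
  refine ⟨σ, Prod.ext (Subtype.ext ?_) (Subtype.ext ?_)⟩
  · rw [Prod.smul_fst, Invol.smul_val, mul_inv_eq_iff_eq_mul]
    refine Equiv.Perm.ext fun p => ?_
    obtain ⟨⟨b, i⟩, rfl⟩ := e.surjective p
    simp only [Equiv.Perm.mul_apply, hx.left, hσ]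
    exact (hy.left _ _).symm
  · rw [Prod.smul_snd, Invol.smul_val, mul_inv_eq_iff_eq_mul]
    refine Equiv.Perm.ext fun p => ?_
    obtain ⟨⟨b, i⟩, rfl⟩ := e.surjective p
    simp only [Equiv.Perm.mul_apply, hx.right, hσ]
    exact (hy.right _ _).symm

theorem IsStandardForm.smul {x : Invol N j × Invol N j} {ι : Type} {s : ι → ℕ}
    {e : (Σ b, Fin (s b)) ≃ Fin N} (hx : IsStandardForm x.1.1 x.2.1 e)
    (σ : Equiv.Perm (Fin N)) :
    IsStandardForm (σ • x).1.1 (σ • x).2.1 (e.trans σ) := by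
  constructor
  · intro b i
    simp [Invol.smul_val, hx.left]
  · intro b i
    simp [Invol.smul_val, hx.right]

/-- If `t` has a single fixed point on each odd block and none on even blocks, then its fixed
points correspond to the odd blocks. -/
theorem card_fixed_eq_card_odd {τ : Equiv.Perm (Fin N)} {ι : Type} [Fintype ι] {s : ι → ℕ}
    {e : (Σ b, Fin (s b)) ≃ Fin N} {t : (n : ℕ) → Fin n → Fin n} {pos : ℕ → ℕ}
    (hpos : ∀ n, n % 2 = 1 → pos n < n) (ht : ∀ n i, t n i = i ↔ n % 2 = 1 ∧ (i : ℕ) = pos n)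
    (h : ∀ b i, τ (e ⟨b, i⟩) = e ⟨b, t _ i⟩) :
    (Finset.univ.filter fun p => τ p = p).card =
      ((Finset.univ.val.map s).filter fun i => Odd i).card := by
  have h1 : ((Finset.univ.val.map s).filter fun i => Odd i).card =
      (Finset.univ.filter fun b => Odd (s b)).card := by
    rw [Multiset.filter_map, Multiset.card_map, Finset.card_def, Finset.filter_val]
    rfl
  rw [h1]
  symm
  have hodd : ∀ b, b ∈ (Finset.univ.filter fun b => Odd (s b)) → s b % 2 = 1 := fun b hb =>
    Nat.odd_iff.1 (Finset.mem_filter.1 hb).2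
  refine Finset.card_bij (fun b hb => e ⟨b, ⟨pos (s b), hpos _ (hodd b hb)⟩⟩) ?_ ?_ ?_
  · intro b hb
    simp only [Finset.mem_filter, Finset.mem_univ, true_and, h]
    rw [(ht _ _).2 ⟨hodd b hb, rfl⟩]
  · intro b hb b' hb' hbb
    exact congrArg Sigma.fst (e.injective hbb)
  · intro p hp
    obtain ⟨⟨b, i⟩, rfl⟩ := e.surjective p
    simp only [Finset.mem_filter, Finset.mem_univ, true_and, h, EmbeddingLike.apply_eq_iff_eq,
      Sigma.mk.injEq, heq_eq_eq] at hp
    obtain ⟨h3, h4⟩ := (ht _ i).1 hp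
    refine ⟨b, by simpa using Nat.odd_iff.2 h3, ?_⟩
    congr 2
    exact Fin.ext h4.symm

theorem IsStandardForm.card_fixed_left {τ κ : Equiv.Perm (Fin N)} {ι : Type} [Fintype ι]
    {s : ι → ℕ} {e : (Σ b, Fin (s b)) ≃ Fin N} (h : IsStandardForm τ κ e) :
    (Finset.univ.filter fun p => τ p = p).card =
      ((Finset.univ.val.map s).filter fun i => Odd i).card :=
  card_fixed_eq_card_odd (t := fun _ => stdLeft) (pos := fun n => n - 1)
    (fun n hn => by omega) (fun _ => stdLeft_eq_self_iff) h.left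

theorem IsStandardForm.card_fixed_right {τ κ : Equiv.Perm (Fin N)} {ι : Type} [Fintype ι]
    {s : ι → ℕ} {e : (Σ b, Fin (s b)) ≃ Fin N} (h : IsStandardForm τ κ e) :
    (Finset.univ.filter fun p => κ p = p).card =
      ((Finset.univ.val.map s).filter fun i => Odd i).card :=
  card_fixed_eq_card_odd (t := fun _ => stdRight) (pos := fun _ => 0)
    (fun n hn => by omega) (fun _ => stdRight_eq_self_iff) h.right

theorem card_fixed_add_sum_cycleType (τ : Equiv.Perm (Fin N)) :
    (Finset.univ.filter fun p => τ p = p).card + τ.cycleType.sum = N := by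
  have h1 := Finset.card_filter_add_card_filter_not (s := Finset.univ) (fun p : Fin N => τ p = p)
  rw [Finset.card_univ, Fintype.card_fin] at h1
  rw [Equiv.Perm.sum_cycleType]
  exact h1

theorem IsStandardForm.numOddParts_eq {x : Invol N j × Invol N j} {ι : Type} [Fintype ι]
    {s : ι → ℕ} {e : (Σ b, Fin (s b)) ≃ Fin N} (h : IsStandardForm x.1.1 x.2.1 e)
    (hs : ∀ b, 0 < s b) : numOddParts (numPartition x.1.1 x.2.1) = N - 2 * j := by
  have h1 := card_fixed_add_sum_cycleType x.1.1
  rw [x.1.2, Multiset.sum_replicate, smul_eq_mul, h.card_fixed_left,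
    ← h.numPartition_parts hs] at h1
  unfold numOddParts
  omega

theorem exists_numPartition_eq (hj : 2 * j ≤ N) {p : Nat.Partition N}
    (hp : numOddParts p = N - 2 * j) :
    ∃ x : Invol N j × Invol N j, ¬ HasSignReversal x ∧ numPartition x.1.1 x.2.1 = p := by
  classical
  let s : p.parts.ToType → ℕ := fun b => b.1
  have hmap : Finset.univ.val.map s = p.parts := Multiset.map_univ_coe _
  have hs : ∀ b, 0 < s b := fun b => p.parts_pos (Multiset.coe_mem)
  have hcard : Fintype.card (Σ b, Fin (s b)) = Fintype.card (Fin N) := by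
    rw [Fintype.card_sigma, Fintype.card_fin]
    simp only [Fintype.card_fin]
    rw [Finset.sum_eq_multiset_sum, hmap, p.parts_sum]
  let e : (Σ b, Fin (s b)) ≃ Fin N := Fintype.equivOfCardEq hcard
  let P : ((n : ℕ) → Fin n → Fin n) → (Σ b, Fin (s b)) → Σ b, Fin (s b) :=
    fun t z => ⟨z.1, t _ z.2⟩
  have hL : Function.Involutive (P fun _ => stdLeft) := fun z => by
    simp [P, stdLeft_stdLeft]
  have hR : Function.Involutive (P fun _ => stdRight) := fun z => by
    simp [P, stdRight_stdRight]
  let τ : Equiv.Perm (Fin N) := (e.symm.trans hL.toPerm).trans e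
  let κ : Equiv.Perm (Fin N) := (e.symm.trans hR.toPerm).trans e
  have hform : IsStandardForm τ κ e := by
    constructor <;> intro b i <;> simp [τ, κ, P]
  -- An involution is a product of transpositions, and since `2 * j ≤ N`, having `N - 2 * j` fixed
  -- points means that there are `j` of them.
  have hcyc : ∀ t : Equiv.Perm (Fin N), (∀ q, t (t q) = q) →
      (Finset.univ.filter fun q => t q = q).card = N - 2 * j →
      t.cycleType = Multiset.replicate j 2 := by
    intro t ht hfix
    have hsq : t ^ 2 = 1 := Equiv.Perm.ext fun q => by simp [pow_two, ht]
    have h1 := Equiv.Perm.cycleType_of_pow_prime_eq_one hsq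
    have h2 := card_fixed_add_sum_cycleType t
    have h3 : t.cycleType.sum = t.cycleType.card * 2 := by
      conv_lhs => rw [h1]
      rw [Multiset.sum_replicate, smul_eq_mul]
    rw [h1]
    congr 1
    omega
  have hfixL : (Finset.univ.filter fun q => τ q = q).card = N - 2 * j := by
    rw [hform.card_fixed_left, hmap]
    exact hp
  have hfixR : (Finset.univ.filter fun q => κ q = q).card = N - 2 * j := by
    rw [hform.card_fixed_right, hmap]
    exact hp
  let x : Invol N j × Invol N j :=
    (⟨τ, hcyc τ (fun q => by simp [τ, hL _]) hfixL⟩, ⟨κ, hcyc κ (fun q => by simp [κ, hR _]) hfixR⟩)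
  have hx : IsStandardForm x.1.1 x.2.1 e := hform
  refine ⟨x, hx.not_hasSignReversal, Nat.Partition.ext ?_⟩
  rw [hx.numPartition_parts hs, hmap]

/-- Pairs without sign reversal are classified up to conjugation by their numerical
characteristic partition. -/
theorem orbit_eq_iff_numPartition_eq (x y : Invol N j × Invol N j) (hx : ¬ HasSignReversal x)
    (hy : ¬ HasSignReversal y) :
    MulAction.orbit (Equiv.Perm (Fin N)) x = MulAction.orbit (Equiv.Perm (Fin N)) y ↔
      numPartition x.1.1 x.2.1 = numPartition y.1.1 y.2.1 := by
  obtain ⟨ι, _, s, e, hs, he⟩ := exists_isStandardForm hx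
  constructor
  · intro h
    obtain ⟨σ, rfl⟩ : y ∈ MulAction.orbit (Equiv.Perm (Fin N)) x := by
      rw [h]
      exact MulAction.mem_orbit_self y
    apply Nat.Partition.ext
    rw [he.numPartition_parts hs]
    exact ((he.smul σ).numPartition_parts hs).symm
  · intro h
    obtain ⟨ι', _, s', e', hs', he'⟩ := exists_isStandardForm hy
    obtain ⟨σ, rfl⟩ := he.exists_smul_eq he' (by
      rw [← he.numPartition_parts hs, ← he'.numPartition_parts hs', h])
    exact (MulAction.orbit_smul σ x).symm

theorem exists_numPartition_eq_iff (hj : 2 * j ≤ N) (p : Nat.Partition N) :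
    (∃ x : Invol N j × Invol N j, ¬ HasSignReversal x ∧ numPartition x.1.1 x.2.1 = p) ↔
      numOddParts p = N - 2 * j := by
  constructor
  · rintro ⟨x, hx, rfl⟩
    obtain ⟨ι, _, s, e, hs, he⟩ := exists_isStandardForm hx
    exact he.numOddParts_eq hs
  · exact exists_numPartition_eq hj

theorem ncard_orbits_eq_card_partitions (hj : 2 * j ≤ N) :
    {O : Set (Invol N j × Invol N j) |
      ∃ x, ¬ HasSignReversal x ∧ O = MulAction.orbit (Equiv.Perm (Fin N)) x}.ncard =
      (Finset.univ.filter fun p : Nat.Partition N => numOddParts p = N - 2 * j).card := by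
  have hex : ∀ p : {p : Nat.Partition N // numOddParts p = N - 2 * j},
      ∃ x : Invol N j × Invol N j, ¬ HasSignReversal x ∧ numPartition x.1.1 x.2.1 = p :=
    fun p => (exists_numPartition_eq_iff hj p).2 p.2
  choose r hr hrp using hex
  have hinj : Function.Injective fun p => MulAction.orbit (Equiv.Perm (Fin N)) (r p) := by
    intro p q h
    apply Subtype.ext
    rw [← hrp p, ← hrp q]
    exact (orbit_eq_iff_numPartition_eq _ _ (hr p) (hr q)).1 h
  have hrange : {O : Set (Invol N j × Invol N j) |
      ∃ x, ¬ HasSignReversal x ∧ O = MulAction.orbit (Equiv.Perm (Fin N)) x} =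
      Set.range fun p => MulAction.orbit (Equiv.Perm (Fin N)) (r p) := by
    ext O
    constructor
    · rintro ⟨x, hx, rfl⟩
      have hp := (exists_numPartition_eq_iff hj _).1 ⟨x, hx, rfl⟩
      exact ⟨⟨_, hp⟩, (orbit_eq_iff_numPartition_eq _ _ (hr _) hx).2 (hrp ⟨_, hp⟩)⟩
    · rintro ⟨p, rfl⟩
      exact ⟨r p, hr p, rfl⟩
  rw [hrange, Set.ncard_range_of_injective hinj, Nat.card_eq_fintype_card,
    Fintype.card_subtype]

end InvolutionModel

theorem proposition4 (N j : ℕ) (hj : 2 * j ≤ N) :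
    -- the dimension of the endomorphism algebra is a number of integer partitions
    Module.finrank ℂ
        (Representation.IntertwiningMap (InvolutionModel.rep N j) (InvolutionModel.rep N j)) =
      (Finset.univ.filter
        fun p : Nat.Partition N => InvolutionModel.numOddParts p = N - 2 * j).card ∧
    -- it is also the number of orbits of pairs without sign reversal
    Module.finrank ℂ
        (Representation.IntertwiningMap (InvolutionModel.rep N j) (InvolutionModel.rep N j)) =
      {O : Set (InvolutionModel.Invol N j × InvolutionModel.Invol N j) |
        ∃ x, ¬ InvolutionModel.HasSignReversal x ∧
          O = MulAction.orbit (Equiv.Perm (Fin N)) x}.ncard ∧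
    -- such orbits are classified by the numerical characteristic partition
    (∀ x y : InvolutionModel.Invol N j × InvolutionModel.Invol N j,
      ¬ InvolutionModel.HasSignReversal x → ¬ InvolutionModel.HasSignReversal y →
        (MulAction.orbit (Equiv.Perm (Fin N)) x = MulAction.orbit (Equiv.Perm (Fin N)) y ↔
          InvolutionModel.numPartition x.1.1 x.2.1 =
            InvolutionModel.numPartition y.1.1 y.2.1)) ∧
    -- and the partitions that occur are those with exactly `N - 2 j` odd parts
    (∀ p : Nat.Partition N,
      (∃ x : InvolutionModel.Invol N j × InvolutionModel.Invol N j,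
        ¬ InvolutionModel.HasSignReversal x ∧
          InvolutionModel.numPartition x.1.1 x.2.1 = p) ↔
        InvolutionModel.numOddParts p = N - 2 * j) := by
  exact ⟨(InvolutionModel.finrank_intertwiningMap N j).trans
      (InvolutionModel.ncard_orbits_eq_card_partitions hj),
    InvolutionModel.finrank_intertwiningMap N j, InvolutionModel.orbit_eq_iff_numPartition_eq,
    InvolutionModel.exists_numPartition_eq_iff hj⟩
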